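/- Call a function $f:A\to\mathbb C$ on an abelian group $A$ *positive-definite* if for all $x_1,\dots,x_n\in A$ the matrix $(f(x_j-x_i))_{i,j}$ is Hermitian and nonnegative-definite. For a topological abelian group $A$ and a continuous, even, positive-definite function $u:A\to(0,\infty)$ with $u(0)=1$, the *ghost-space (of the first kind)* $A_u$ is $A$ together with the convolution of point measures $\delta_x*\delta_y=\frac{u(x)u(y)}{u(x+y)}\,\delta_{x+y}$. **Proposition 3.2.** Let $G$ be a locally compact abelian group, $H$ a closed subgroup, and $u:G\to(0,\infty)$ a continuous, even, positive-definite function with $u(0)=1$. Let $m_G$, $m_H$ be Haar measures on $G$, $H$, and suppose that $\int_G u\,dm_G$ and $\int_H u\,dm_H$ are both finite. Then $\int_H u(x+y)\,dm_H(y)$ is finite for every $x\in G$, so that $$v(x+H)=\frac{\int_H u(x+y)\,dm_H(y)}{\int_H u(y)\,dm_H(y)}$$ is a well-defined function on $G/H$. If $v$ is continuous, then $v$ is positive-definite, and moreover $v$ is positive and even with $v(0)=1$, so that $(G/H)_v$ is a ghost-space of the first kind (the quotient $G_u/H_u$). -/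

import Mathlib

open MeasureTheory
open scoped ComplexOrder

/-- A complex-valued function `f` on an abelian group is positive-definite if for all
`x₁, …, xₙ` the matrix `f (x_j - x_i)` is Hermitian and nonnegative-definite. -/
def IsPositiveDefinite {A : Type*} [AddCommGroup A] (f : A → ℂ) : Prop :=
  ∀ (n : ℕ) (x : Fin n → A),
    (Matrix.of fun i j : Fin n => f (x j - x i)).PosSemidef

/-- A ghost-space (of the first kind) `A_u` on a topological abelian group `A`: the convolution of
Borel point measures `δ_x * δ_y = (u x * u y / u (x + y)) δ_{x + y}` attached to a positive,
positive-definite, even, continuous function `u` with `u 0 = 1`. -/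
structure GhostSpace (A : Type*) [AddCommGroup A] [TopologicalSpace A] where
  /-- the function `u` -/
  weight : A → ℝ
  continuous_weight : Continuous weight
  weight_pos : ∀ x, 0 < weight x
  weight_neg : ∀ x, weight (-x) = weight x
  weight_zero : weight 0 = 1
  posDef_weight : IsPositiveDefinite fun x => (weight x : ℂ)
  /-- the measure `δ_x * δ_y` -/
  conv : A → A → @Measure A (borel A)
  conv_eq : ∀ x y, conv x y =
    ENNReal.ofReal (weight x * weight y / weight (x + y)) • @Measure.dirac A (borel A) (x + y)

section Quotient

variable {G : Type*} [AddCommGroup G] [TopologicalSpace G] [IsTopologicalAddGroup G]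
  [MeasurableSpace G] [BorelSpace G]

/-- The integral of a function over `x + H` depends only on the coset of `x`. -/
theorem integral_coset_eq (H : AddSubgroup G) (m : Measure H) [m.IsAddHaarMeasure] (u : G → ℝ)
    {a b : G} (h : -a + b ∈ H) :
    ∫ y : H, u (a + y) ∂m = ∫ y : H, u (b + y) ∂m := by
  rw [← integral_add_left_eq_self (fun y : H => u (a + y)) ⟨-a + b, h⟩]
  congr 1
  funext y
  simp [← add_assoc]

/-- The function `v (x + H) = (∫_H u (x + y) dm y) / (∫_H u y dm y)` on `G ⧸ H`. -/
noncomputable def cosetAverage (H : AddSubgroup G) (m : Measure H) [m.IsAddHaarMeasure]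
    (u : G → ℝ) : G ⧸ H → ℝ :=
  Quotient.lift (fun x : G => (∫ y : H, u (x + y) ∂m) / ∫ y : H, u y ∂m) fun a b h => by
    have h' : -a + b ∈ H := QuotientAddGroup.leftRel_apply.mp h
    simp only [integral_coset_eq H m u h']

end Quotient

/-!
A positive-definite `f` has the form `f (y - x) = ⟨e x, e y⟩` in a Hilbert space, so its double
average over a set `A` of finite measure is `‖∫_A e‖² ≥ 0`.

A positive integrable positive-definite function on `H` provides Følner sets. Its superlevel sets
`K` have finite measure, and by uniform continuity `K + K` is covered by finitely many translates
of `K`. The measure of the `n`-fold sums of `K` therefore grows polynomially in `n`, so one of them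
is almost invariant under `K`. Averaging over such sets gives `0 ≤ ∫ P` for an integrable
positive-definite `P`, and shows that a positive-definite `r` below a nonnegative integrable
function is integrable.

The second fact applies to `r y = 2 u y - u (x + y) - u (-x + y)`, which yields integrability on
the coset `x + H`. The first applies to `y ↦ ∑ i j, conj (c i) * c j * u (x j - x i + y)`, whose
integral is the quadratic form of `v` up to a positive factor.
-/

open Filter Set Topology
open scoped Pointwise

section PositiveDefinite

variable {A B : Type*} [AddCommGroup A] [AddCommGroup B] {f : A → ℂ}

theorem isPositiveDefinite_of_sum_nonneg
    (hf : ∀ (n : ℕ) (x : Fin n → A) (c : Fin n → ℂ),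
      0 ≤ ∑ i, ∑ j, star (c i) * c j * f (x j - x i)) :
    IsPositiveDefinite f := fun n x => by
  rw [← Matrix.isPositive_toEuclideanLin_iff, LinearMap.isPositive_iff_complex]
  intro c
  have hform : inner ℂ ((Matrix.of fun i j => f (x j - x i)).toEuclideanLin c) c =
      star (∑ i, ∑ j, star (c i) * c j * f (x j - x i)) := by
    simp [EuclideanSpace.inner_eq_star_dotProduct, Matrix.ofLp_toLpLin, Matrix.toLin'_apply,
      dotProduct, Matrix.mulVec, Finset.mul_sum, mul_comm, mul_left_comm]
  have hnonneg := star_nonneg_iff.2 (hf n x c)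
  rw [← hform, RCLike.nonneg_iff] at hnonneg
  exact ⟨RCLike.conj_eq_iff_re.1 (RCLike.conj_eq_iff_im.2 hnonneg.2), hnonneg.1⟩

namespace IsPositiveDefinite

theorem sum_nonneg (hf : IsPositiveDefinite f) {n : ℕ} (x : Fin n → A) (c : Fin n → ℂ) :
    0 ≤ ∑ i, ∑ j, star (c i) * c j * f (x j - x i) := by
  simpa [dotProduct, Matrix.mulVec, Finset.mul_sum, mul_assoc, mul_comm, mul_left_comm]
    using (hf n x).dotProduct_mulVec_nonneg c

theorem star_apply (hf : IsPositiveDefinite f) (x : A) : star (f x) = f (-x) := by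
  simpa using (hf 2 ![x, 0]).1.apply 0 1

theorem apply_neg_of_real {v : A → ℝ} (hv : IsPositiveDefinite fun x => (v x : ℂ)) (x : A) :
    v (-x) = v x :=
  Complex.ofReal_injective ((hv.star_apply x).symm.trans (Complex.conj_ofReal (v x)))

theorem const_mul (hf : IsPositiveDefinite f) {c : ℂ} (hc : 0 ≤ c) :
    IsPositiveDefinite fun x => c * f x := fun n x => (hf n x).smul hc

theorem comp_addMonoidHom (hf : IsPositiveDefinite f) (φ : B →+ A) :
    IsPositiveDefinite fun x => f (φ x) := fun n x => by
  simpa only [map_sub] using hf n fun i => φ (x i)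

end IsPositiveDefinite

theorem isPositiveDefinite_of_comp_surjective {φ : B →+ A} (hφ : Function.Surjective φ)
    (hf : IsPositiveDefinite fun x => f (φ x)) : IsPositiveDefinite f := fun n x => by
  obtain ⟨y, rfl⟩ := hφ.comp_left x
  simpa only [map_sub, Function.comp_apply] using hf n y

theorem isPositiveDefinite_of_inner_eq {E : Type*} [NormedAddCommGroup E] [InnerProductSpace ℂ E]
    {e : A → E} (he : ∀ x y, inner ℂ (e x) (e y) = f (y - x)) : IsPositiveDefinite f :=
  fun n x => by
  simpa only [Matrix.gram, he] using Matrix.posSemidef_gram ℂ fun i => e (x i)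

namespace IsPositiveDefinite

theorem posSemidef (hf : IsPositiveDefinite f) :
    (Matrix.of fun x y : A => f (y - x)).PosSemidef := by
  refine ⟨Matrix.ext fun x y => ?_, fun c => ?_⟩
  · simpa using hf.star_apply (x - y)
  · have h := hf.sum_nonneg (fun i => (c.support.equivFin.symm i : A))
      fun i => c (c.support.equivFin.symm i)
    simp only [Matrix.of_apply, Finsupp.sum]
    rw [← Finset.sum_coe_sort c.support]
    simp_rw [← Finset.sum_coe_sort c.support (fun y => _ * f (y - _) * c y)]
    rw [← c.support.equivFin.symm.sum_comp]
    simp_rw [← c.support.equivFin.symm.sum_comp (fun y => _ * f (y - _) * c y)]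
    simpa only [mul_right_comm] using h

theorem exists_inner_eq.{v} {A : Type v} [AddCommGroup A] {f : A → ℂ} (hf : IsPositiveDefinite f) :
    ∃ (E : Type v) (_ : NormedAddCommGroup E) (_ : InnerProductSpace ℂ E) (_ : CompleteSpace E)
      (e : A → E), ∀ x y, inner ℂ (e x) (e y) = f (y - x) := by
  have hstar (x : A) : starRingEnd ℂ (f x) = f (-x) := hf.star_apply x
  let K : Matrix A A (ℂ →L[ℂ] ℂ) := .of fun x y => f (y - x) • ContinuousLinearMap.id ℂ ℂ
  have hK : K.PosSemidef := by
    have hiff := (RKHS.posSemidef_tfae (𝕜 := ℂ) (K := K)).out 0 2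
    refine hiff.2 ⟨?_, fun c => ?_⟩
    · ext x y
      simp [K, Matrix.conjTranspose_apply, ContinuousLinearMap.star_eq_adjoint, hstar,
        ContinuousLinearMap.adjoint_id]
    · have h := (Complex.le_def.1 (hf.posSemidef.2 c)).1
      simpa [K, hstar, Finsupp.sum, mul_comm, mul_left_comm, mul_assoc] using h
  have : Fact K.PosSemidef := ⟨hK⟩
  refine ⟨RKHS.OfKernel K, inferInstance, inferInstance, inferInstance,
    fun x => RKHS.kerFun (RKHS.OfKernel K) x (1 : ℂ), fun x y => ?_⟩
  rw [← RKHS.kernel_inner, RKHS.OfKernel.kernel_ofKernel]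
  simp [K, hstar]

theorem sum_translates (hf : IsPositiveDefinite f) {n : ℕ} (x : Fin n → A) (c : Fin n → ℂ) :
    IsPositiveDefinite fun t => ∑ i, ∑ j, star (c i) * c j * f (x j - x i + t) := by
  obtain ⟨E, _, _, _, e, he⟩ := hf.exists_inner_eq
  refine isPositiveDefinite_of_inner_eq (e := fun t => ∑ i, c i • e (x i + t)) fun s t => ?_
  simp only [sum_inner, inner_sum, inner_smul_left, inner_smul_right, he, add_sub_add_comm,
    starRingEnd_apply, Finset.mul_sum]
  rw [Finset.sum_comm]
  simp only [mul_left_comm, mul_assoc]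

end IsPositiveDefinite

end PositiveDefinite

section ContinuousPositiveDefinite

variable {A E : Type*} [AddCommGroup A] [NormedAddCommGroup E] [InnerProductSpace ℂ E]
  {f : A → ℂ} {e : A → E}

theorem norm_of_inner_eq (he : ∀ x y, inner ℂ (e x) (e y) = f (y - x)) (x : A) :
    ‖e x‖ = √(f 0).re := by
  rw [norm_eq_sqrt_re_inner (𝕜 := ℂ), he, sub_self, RCLike.re_eq_complex_re]

theorem norm_sub_of_inner_eq (he : ∀ x y, inner ℂ (e x) (e y) = f (y - x)) (x y : A) :
    ‖e x - e y‖ = √(2 * ((f 0).re - (f (y - x)).re)) := by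
  rw [← Real.sqrt_sq (norm_nonneg _), norm_sub_sq (𝕜 := ℂ), ← inner_self_eq_norm_sq (𝕜 := ℂ),
    ← inner_self_eq_norm_sq (𝕜 := ℂ), he, he, he, sub_self, sub_self]
  congr 1
  simp only [RCLike.re_eq_complex_re]
  ring

theorem IsPositiveDefinite.norm_apply_le (hf : IsPositiveDefinite f) (x : A) :
    ‖f x‖ ≤ (f 0).re := by
  obtain ⟨E, _, _, _, e, he⟩ := hf.exists_inner_eq
  have hf0 : 0 ≤ (f 0).re := by
    simpa only [he, sub_self, RCLike.re_eq_complex_re] using inner_self_nonneg (𝕜 := ℂ) (x := e 0)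
  calc ‖f x‖ = ‖inner ℂ (e 0) (e x)‖ := by rw [he, sub_zero]
    _ ≤ ‖e 0‖ * ‖e x‖ := norm_inner_le_norm _ _
    _ = (f 0).re := by rw [norm_of_inner_eq he, norm_of_inner_eq he, Real.mul_self_sqrt hf0]

variable [TopologicalSpace A] [IsTopologicalAddGroup A]

theorem continuous_of_inner_eq (he : ∀ x y, inner ℂ (e x) (e y) = f (y - x))
    (hfc : Continuous f) : Continuous e := by
  refine continuous_iff_continuousAt.2 fun x => tendsto_iff_norm_sub_tendsto_zero.2 ?_
  have hcont : Continuous fun y => √(2 * ((f 0).re - (f (x - y)).re)) := by fun_prop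
  simpa [norm_sub_of_inner_eq he] using hcont.tendsto x

/- The integral is taken weakly because the range of `φ` need not be separable. -/
theorem exists_inner_eq_integral {X : Type*} [MeasurableSpace X] [CompleteSpace E]
    (μ : Measure X) [IsFiniteMeasure μ] {φ : X → E} {C : ℝ} (hC : ∀ x, ‖φ x‖ ≤ C)
    (hφ : ∀ ξ, AEStronglyMeasurable (fun x => inner ℂ (φ x) ξ) μ) :
    ∃ v : E, ∀ ξ, inner ℂ v ξ = ∫ x, inner ℂ (φ x) ξ ∂μ := by
  have hbound (ξ : E) (x : X) : ‖inner ℂ (φ x) ξ‖ ≤ C * ‖ξ‖ :=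
    (norm_inner_le_norm _ _).trans (mul_le_mul_of_nonneg_right (hC x) (norm_nonneg ξ))
  have hint (ξ : E) : Integrable (fun x => inner ℂ (φ x) ξ) μ :=
    .of_bound (hφ ξ) _ (ae_of_all _ (hbound ξ))
  let L : E →ₗ[ℂ] ℂ :=
    { toFun := fun ξ => ∫ x, inner ℂ (φ x) ξ ∂μ
      map_add' := fun ξ η => by simp only [inner_add_right, integral_add (hint ξ) (hint η)]
      map_smul' := fun a ξ => by
        simp only [inner_smul_right, integral_const_mul, RingHom.id_apply, smul_eq_mul] }
  let L' : StrongDual ℂ E := L.mkContinuous (C * μ.real univ) fun ξ =>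
    (norm_integral_le_of_norm_le_const (ae_of_all _ (hbound ξ))).trans_eq (mul_right_comm _ _ _)
  exact ⟨(InnerProductSpace.toDual ℂ E).symm L', fun ξ => InnerProductSpace.toDual_symm_apply⟩

theorem IsPositiveDefinite.eventually_norm_add_sub_lt (hf : IsPositiveDefinite f)
    (hfc : Continuous f) {ε : ℝ} (hε : 0 < ε) : ∀ᶠ h in 𝓝 0, ∀ x, ‖f (x + h) - f x‖ < ε := by
  obtain ⟨E, _, _, _, e, he⟩ := hf.exists_inner_eq
  have he_cont := continuous_of_inner_eq he hfc
  have hsmall : ∀ᶠ h in 𝓝 0, ‖e 0‖ * ‖e h - e 0‖ < ε := by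
    have hcont : Continuous fun h => ‖e 0‖ * ‖e h - e 0‖ := by fun_prop
    exact (hcont.tendsto 0).eventually_lt_const (by simpa using hε)
  filter_upwards [hsmall] with h hh x
  calc ‖f (x + h) - f x‖ = ‖inner ℂ (e (-x)) (e h - e 0)‖ := by
        rw [inner_sub_right, he, he, sub_neg_eq_add, sub_neg_eq_add, zero_add, add_comm h x]
    _ ≤ ‖e (-x)‖ * ‖e h - e 0‖ := norm_inner_le_norm _ _
    _ = ‖e 0‖ * ‖e h - e 0‖ := by rw [norm_of_inner_eq he, norm_of_inner_eq he 0]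
    _ < ε := hh

end ContinuousPositiveDefinite

theorem IsPositiveDefinite.integrableOn_of_real {A : Type*} [AddCommGroup A] [TopologicalSpace A]
    [MeasurableSpace A] [OpensMeasurableSpace A] {r : A → ℝ}
    (hr : IsPositiveDefinite fun x => (r x : ℂ)) (hrc : Continuous r) {m : Measure A} {s : Set A}
    (hs : m s ≠ ⊤) : IntegrableOn r s m :=
  .of_bound hs.lt_top hrc.aestronglyMeasurable (r 0)
    (ae_of_all _ fun x => by simpa using hr.norm_apply_le x)

section FiniteMeasure

variable {A : Type*} [AddCommGroup A] [TopologicalSpace A] [MeasurableSpace A]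
  [OpensMeasurableSpace A] [IsTopologicalAddGroup A] {f : A → ℂ} (μ : Measure A)
  [IsFiniteMeasure μ]

theorem exists_inner_eq_integral_sub {E : Type*} [NormedAddCommGroup E] [InnerProductSpace ℂ E]
    [CompleteSpace E] {e : A → E} (he : ∀ x y, inner ℂ (e x) (e y) = f (y - x))
    (hfc : Continuous f) : ∃ v : E, (∀ h, inner ℂ (e h) v = ∫ k, f (k - h) ∂μ) ∧
      inner ℂ v v = ∫ h, ∫ k, f (k - h) ∂μ ∂μ := by
  have he_cont := continuous_of_inner_eq he hfc
  obtain ⟨v, hv⟩ := exists_inner_eq_integral μ (fun x => (norm_of_inner_eq he x).le)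
    fun ξ => Continuous.aestronglyMeasurable (by fun_prop)
  have hv' (h : A) : inner ℂ (e h) v = ∫ k, f (k - h) ∂μ := by
    rw [← inner_conj_symm, hv, ← integral_conj]
    simp only [inner_conj_symm]
    simp only [he]
  exact ⟨v, hv', by simp only [hv, hv']⟩

namespace IsPositiveDefinite

variable (hf : IsPositiveDefinite f) (hfc : Continuous f)
include hf hfc

theorem continuous_integral_sub : Continuous fun h => ∫ k, f (k - h) ∂μ := by
  obtain ⟨E, _, _, _, e, he⟩ := hf.exists_inner_eq
  obtain ⟨v, hv, -⟩ := exists_inner_eq_integral_sub μ he hfc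
  have he_cont := continuous_of_inner_eq he hfc
  simp only [← hv]
  fun_prop

theorem integrable_integral_sub : Integrable (fun h => ∫ k, f (k - h) ∂μ) μ :=
  .of_bound (hf.continuous_integral_sub μ hfc).aestronglyMeasurable ((f 0).re * μ.real univ) <|
    ae_of_all _ fun h => norm_integral_le_of_norm_le_const <|
      ae_of_all _ fun k => hf.norm_apply_le (k - h)

theorem integral_integral_sub_nonneg : 0 ≤ ∫ h, ∫ k, f (k - h) ∂μ ∂μ := by
  obtain ⟨E, _, _, _, e, he⟩ := hf.exists_inner_eq
  obtain ⟨v, -, hv⟩ := exists_inner_eq_integral_sub μ he hfc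
  rw [← hv, inner_self_eq_norm_sq_to_K]
  exact pow_nonneg (RCLike.ofReal_nonneg.2 (norm_nonneg v)) 2

end IsPositiveDefinite

end FiniteMeasure

section Sumsets

variable {X : Type*} [AddCommGroup X]

theorem card_nsmul_le [DecidableEq X] (F : Finset X) (n : ℕ) :
    (n • F).card ≤ (n + 1) ^ F.card := by
  let combination (g : F → ℕ) : X := ∑ a, g a • (a : X)
  have hsub : n • F ⊆
      (Fintype.piFinset fun _ : F => Finset.range (n + 1)).image combination := fun x hx => by
    obtain ⟨t, rfl⟩ := Finset.mem_nsmul.1 hx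
    refine Finset.mem_image.2 ⟨fun a => (Finset.univ.filter fun i => t i = a).card,
      Fintype.mem_piFinset.2 fun a => Finset.mem_range.2 ?_, ?_⟩
    · exact Nat.lt_succ_of_le ((Finset.card_le_univ _).trans_eq (Fintype.card_fin n))
    · rw [List.sum_ofFn, ← Finset.sum_fiberwise Finset.univ t]
      refine Finset.sum_congr rfl fun a _ => ?_
      rw [Finset.sum_congr rfl fun i hi => by rw [(Finset.mem_filter.1 hi).2], Finset.sum_const]
  calc (n • F).card
      ≤ (Fintype.piFinset fun _ : F => Finset.range (n + 1)).card :=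
        (Finset.card_le_card hsub).trans Finset.card_image_le
    _ = (n + 1) ^ F.card := by simp

theorem add_nsmul_subset {K F : Set X} (h : K + K ⊆ F + K) (n : ℕ) :
    K + n • K ⊆ n • F + K := by
  induction n with
  | zero => simp only [zero_nsmul, add_zero, zero_add, subset_rfl]
  | succ n ih =>
    calc K + (n + 1) • K = K + n • K + K := by rw [succ_nsmul, add_assoc]
      _ ⊆ n • F + (K + K) := by rw [← add_assoc]; exact add_subset_add_right ih
      _ ⊆ n • F + (F + K) := add_subset_add_left h
      _ = (n + 1) • F + K := by rw [succ_nsmul, add_assoc]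

end Sumsets

theorem exists_succ_le_mul_of_le_pow {a : ℕ → ℝ} {C ε : ℝ} {d : ℕ} (ha0 : 0 < a 0)
    (ha : ∀ n : ℕ, a n ≤ (n + 1) ^ d * C) (hε : 0 < ε) : ∃ n, a (n + 1) ≤ (1 + ε) * a n := by
  by_contra! h
  have hexp (n : ℕ) : (1 + ε) ^ n * a 0 ≤ a n := by
    induction n with
    | zero => simp
    | succ n ih =>
      rw [pow_succ', mul_assoc]
      exact (mul_le_mul_of_nonneg_left ih (by positivity)).trans (h n).le
  have hC : 0 < C := by simpa using ha0.trans_le (ha 0)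
  have hlim := (tendsto_add_atTop_iff_nat 1).2
    (tendsto_pow_const_div_const_pow_of_one_lt d (r := 1 + ε) (by linarith))
  obtain ⟨n, hn⟩ := (hlim.eventually_lt_const (u := a 0 / (C * (1 + ε))) (by positivity)).exists
  have hlt : (n + 1 : ℝ) ^ d * C < (1 + ε) ^ n * a 0 := by
    rw [div_lt_div_iff₀ (by positivity) (by positivity), pow_succ (1 + ε)] at hn
    push_cast at hn
    refine lt_of_mul_lt_mul_right ?_ (show 0 ≤ 1 + ε by positivity)
    linarith
  exact ((hexp n).trans (ha n)).not_gt hlt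

section Covering

variable {X : Type*} [AddCommGroup X] [MeasurableSpace X] (m : Measure X)
  [m.IsAddLeftInvariant]

theorem measure_finset_add_le (F : Finset X) (K : Set X) :
    m ((F : Set X) + K) ≤ F.card * m K := by
  rw [← vadd_eq_add, ← iUnion_vadd_set]
  refine (measure_biUnion_finset_le F _).trans_eq ?_
  simp only [measure_vadd, Finset.sum_const, nsmul_eq_mul]

theorem measure_add_nsmul_le {K : Set X} {F : Finset X} (hKF : K + K ⊆ F + K) (n : ℕ) :
    m (K + n • K) ≤ ((n + 1) ^ F.card : ℕ) * m K := by
  classical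
  calc m (K + n • K) ≤ m (((n • F : Finset X) : Set X) + K) := by
        rw [Finset.coe_nsmul]
        exact measure_mono (add_nsmul_subset hKF n)
    _ ≤ (n • F).card * m K := measure_finset_add_le m _ K
    _ ≤ ((n + 1) ^ F.card : ℕ) * m K := by
        gcongr
        exact card_nsmul_le F n

theorem exists_finset_subset_add_sub [MeasurableAdd X] {S V : Set X} (hV : MeasurableSet V)
    (hV0 : m V ≠ 0) (hSV : m (S + V) ≠ ⊤) : ∃ F : Finset X, S ⊆ (F : Set X) + (V - V) := by
  have hVne : V.Nonempty := nonempty_of_measure_ne_zero hV0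
  obtain ⟨T, hTS, hT, hcov⟩ := Vitali.exists_disjoint_subfamily_covering_enlargement
    (fun x => x +ᵥ V) S (fun _ => 0) 2 (by norm_num) (fun _ _ => le_rfl) 0 (fun _ _ => le_rfl)
    fun x _ => hVne.vadd_set
  have hTfin : T.Finite := by
    have hunion : (⋃ x : T, (x : X) +ᵥ V) ⊆ S + V :=
      iUnion_subset fun x => vadd_set_subset_add (hTS x.2)
    have hfin := Measure.finite_const_le_meas_of_disjoint_iUnion m (pos_iff_ne_zero.2 hV0)
      (fun x : T => hV.const_vadd (x : X))
      (fun x y hxy => hT x.2 y.2 (Subtype.coe_injective.ne hxy))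
      (ne_top_of_le_ne_top hSV (measure_mono hunion))
    simp only [measure_vadd, le_refl, ofPred_true] at hfin
    exact finite_coe_iff.1 (finite_univ_iff.1 hfin)
  refine ⟨hTfin.toFinset, fun s hs => ?_⟩
  obtain ⟨t, ht, ⟨z, ⟨v, hv, hvz⟩, ⟨v', hv', hvz'⟩⟩, -⟩ := hcov s hs
  refine ⟨t, by simpa using ht, v' - v, sub_mem_sub hv' hv, ?_⟩
  have hsum : s + v = t + v' := hvz.trans hvz'.symm
  change t + (v' - v) = s
  rw [← add_sub_assoc, ← hsum, add_sub_cancel_right]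

end Covering

section Folner

variable {X : Type*} [AddCommGroup X] [MeasurableSpace X]

/-- `B` is a Følner set for translations by `K`: up to a proportion `ε`, the enlarged set `B + K`
has the same finite, nonzero measure as `B`. -/
structure IsFolnerSet (m : Measure X) (K : Set X) (ε : ℝ) (B : Set X) : Prop where
  measurableSet : MeasurableSet B
  measurableSet_add : MeasurableSet (B + K)
  subset_add : B ⊆ B + K
  measureReal_pos : 0 < m.real B
  measure_add_ne_top : m (B + K) ≠ ⊤
  measureReal_sdiff_le : m.real ((B + K) \ B) ≤ ε * m.real B

/-- A sequence of Følner sets `B n` for translations by `K n`, where the sets `K n` exhaust `X`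
and the error proportions `1 / (n + 1)` tend to `0`. -/
structure IsFolnerSequence (m : Measure X) (K B : ℕ → Set X) : Prop where
  aecover : AECover m atTop K
  isFolnerSet : ∀ n, IsFolnerSet m (K n) (1 / (n + 1)) (B n)

variable [TopologicalSpace X] [IsTopologicalAddGroup X] [BorelSpace X] {m : Measure X}
  [m.IsAddLeftInvariant] [m.IsOpenPosMeasure]

theorem exists_isFolnerSet {K : Set X} (hK : IsOpen K) (hK0 : 0 ∈ K) (hKfin : m K ≠ ⊤)
    {F : Finset X} (hKF : K + K ⊆ F + K) {ε : ℝ} (hε : 0 < ε) : ∃ B, IsFolnerSet m K ε B := by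
  have hbound (n : ℕ) : ((n + 1) ^ F.card : ℕ) * m K ≠ ⊤ :=
    ENNReal.mul_ne_top (ENNReal.natCast_ne_top _) hKfin
  have hfin (n : ℕ) : m (K + n • K) ≠ ⊤ :=
    ne_top_of_le_ne_top (hbound n) (measure_add_nsmul_le m hKF n)
  have hgrowth (n : ℕ) : m.real (K + n • K) ≤ (n + 1) ^ F.card * m.real K := by
    have h := ENNReal.toReal_mono (hbound n) (measure_add_nsmul_le m hKF n)
    rw [ENNReal.toReal_mul, ENNReal.toReal_natCast] at h
    exact_mod_cast h
  have hpos (n : ℕ) : 0 < m.real (K + n • K) :=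
    ENNReal.toReal_pos
      (hK.add_right.measure_pos m ⟨0 + 0, add_mem_add hK0 (zero_mem_nsmul hK0)⟩).ne' (hfin n)
  obtain ⟨n, hn⟩ := exists_succ_le_mul_of_le_pow (hpos 0) hgrowth hε
  have hsucc : K + n • K + K = K + (n + 1) • K := by rw [succ_nsmul, add_assoc]
  have hsub : K + n • K ⊆ K + n • K + K := fun x hx => ⟨x, hx, 0, hK0, add_zero x⟩
  rw [← hsucc] at hn
  refine ⟨K + n • K, hK.add_right.measurableSet, hK.add_left.measurableSet, hsub, hpos n,
    hsucc ▸ hfin (n + 1), ?_⟩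
  rw [measureReal_sdiff hsub hK.add_right.measurableSet (hsucc ▸ hfin (n + 1))]
  linarith

theorem exists_finset_superlevel_subset {w : X → ℝ} (hw : IsPositiveDefinite fun x => (w x : ℂ))
    (hwc : Continuous w) (hwint : Integrable w m) {ε : ℝ} (hε : 0 < ε) {N : Set X}
    (hN : N ∈ 𝓝 0) : ∃ F : Finset X, {x | ε < w x} ⊆ (F : Set X) + N := by
  obtain ⟨V, hV, hVN⟩ := exists_nhds_half_neg hN
  obtain ⟨U, hUV, hUo, hU0⟩ := mem_nhds_iff.1
    (inter_mem hV (hw.eventually_norm_add_sub_lt (by fun_prop) (half_pos hε)))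
  have hsub : {x | ε < w x} + U ⊆ {x | ε / 2 < w x} := by
    rintro _ ⟨x, hx, h, hh, rfl⟩
    have hclose : ‖(w (x + h) : ℂ) - w x‖ < ε / 2 := (hUV hh).2 x
    rw [← Complex.ofReal_sub, Complex.norm_real, Real.norm_eq_abs] at hclose
    have hx : ε < w x := hx
    change ε / 2 < w (x + h)
    linarith [neg_lt_of_abs_lt hclose]
  obtain ⟨F, hF⟩ := exists_finset_subset_add_sub m hUo.measurableSet
    (hUo.measure_pos m ⟨0, hU0⟩).ne'
    (measure_ne_top_of_subset hsub (hwint.measure_gt_lt_top (half_pos hε)).ne)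
  refine ⟨F, hF.trans (add_subset_add_left ?_)⟩
  rintro _ ⟨v, hv, v', hv', rfl⟩
  exact hVN v (hUV hv).1 v' (hUV hv').1

theorem exists_finset_superlevel_add_subset {w : X → ℝ}
    (hw : IsPositiveDefinite fun x => (w x : ℂ)) (hwc : Continuous w) (hwint : Integrable w m)
    {ε : ℝ} (hε : 0 < ε) (hε0 : ε < w 0) :
    ∃ F : Finset X, {x | ε < w x} + {x | ε < w x} ⊆ (F : Set X) + {x | ε < w x} := by
  classical
  obtain ⟨N, hNo, hN0, hN⟩ := exists_open_nhds_zero_add_subset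
    ((isOpen_lt continuous_const hwc).mem_nhds hε0)
  obtain ⟨F, hF⟩ := exists_finset_superlevel_subset hw hwc hwint hε (hNo.mem_nhds hN0)
  refine ⟨F + F, (add_subset_add hF hF).trans ?_⟩
  rw [Finset.coe_add, add_add_add_comm]
  exact add_subset_add_left hN

theorem exists_isFolnerSequence {w : X → ℝ} (hw : IsPositiveDefinite fun x => (w x : ℂ))
    (hwc : Continuous w) (hw0 : ∀ x, 0 < w x) (hwint : Integrable w m) :
    ∃ K B, IsFolnerSequence m K B := by
  have hε (n : ℕ) : 0 < w 0 / (n + 2) := div_pos (hw0 0) (by positivity)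
  have hε0 (n : ℕ) : w 0 / (n + 2) < w 0 :=
    div_lt_self (hw0 0) (by linarith [n.cast_nonneg (α := ℝ)])
  have hopen (n : ℕ) : IsOpen {x | w 0 / (n + 2) < w x} := isOpen_lt continuous_const hwc
  have hB (n : ℕ) : ∃ B, IsFolnerSet m {x | w 0 / (n + 2) < w x} (1 / (n + 1)) B := by
    obtain ⟨F, hF⟩ := exists_finset_superlevel_add_subset hw hwc hwint (hε n) (hε0 n)
    exact exists_isFolnerSet (hopen n) (hε0 n) (hwint.measure_gt_lt_top (hε n)).ne hF
      (by positivity)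
  choose B hB using hB
  refine ⟨_, B, ⟨ae_of_all _ fun x => ?_, fun n => (hopen n).measurableSet⟩, hB⟩
  have hlim : Tendsto (fun n : ℕ => w 0 / (n + 2 : ℝ)) atTop (𝓝 0) :=
    tendsto_const_nhds.div_atTop (tendsto_atTop_add_const_right _ _ tendsto_natCast_atTop_atTop)
  exact hlim.eventually_lt_const (hw0 x)

end Folner

section Averaging

variable {X : Type*} [AddCommGroup X] {K B : Set X} {ε : ℝ}

theorem subset_preimage_add_right {h : X} (hh : h ∈ B) : K ⊆ (fun t => t + h) ⁻¹' (B + K) :=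
  fun t ht => ⟨h, hh, t, ht, add_comm h t⟩

variable [MeasurableSpace X] {m : Measure X}

namespace IsFolnerSet

variable {E : Type*} [NormedAddCommGroup E] [NormedSpace ℝ E] (hB : IsFolnerSet m K ε B)
include hB

theorem measure_ne_top : m B ≠ ⊤ :=
  measure_ne_top_of_subset hB.subset_add hB.measure_add_ne_top

theorem measureReal_add_pos : 0 < m.real (B + K) :=
  hB.measureReal_pos.trans_le (measureReal_mono hB.subset_add hB.measure_add_ne_top)

theorem setIntegral_add_setIntegral_sdiff {F : X → E} (hF : IntegrableOn F (B + K) m) :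
    ∫ h in B, F h ∂m + ∫ h in (B + K) \ B, F h ∂m = ∫ h in B + K, F h ∂m := by
  rw [← setIntegral_union disjoint_sdiff_right (hB.measurableSet_add.diff hB.measurableSet)
    (hF.mono_set hB.subset_add) (hF.mono_set sdiff_subset), union_sdiff_cancel hB.subset_add]

end IsFolnerSet

variable [TopologicalSpace X] [IsTopologicalAddGroup X] [BorelSpace X] [m.IsAddLeftInvariant]
  {E : Type*} [NormedAddCommGroup E] [NormedSpace ℝ E]

theorem setIntegral_sub_right_eq (P : X → E) (A : Set X) (h : X) :
    ∫ k in A, P (k - h) ∂m = ∫ t in (fun t => t + h) ⁻¹' A, P t ∂m := by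
  simpa using ((measurePreserving_add_right m h).setIntegral_preimage_emb
    (measurableEmbedding_addRight h) (fun k => P (k - h)) A).symm

theorem norm_setIntegral_sub_right_sub_le {P : X → E} (hP : Integrable P m) {A L : Set X}
    (hA : MeasurableSet A) {h : X} (hL : L ⊆ (fun t => t + h) ⁻¹' A) :
    ‖∫ k in A, P (k - h) ∂m - ∫ t, P t ∂m‖ ≤ ∫ t in Lᶜ, ‖P t‖ ∂m := by
  have hAh : MeasurableSet ((fun t => t + h) ⁻¹' A) := measurable_add_const h hA
  rw [setIntegral_sub_right_eq, ← integral_add_compl hAh hP, sub_add_cancel_left, norm_neg]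
  exact (norm_integral_le_integral_norm _).trans
    (setIntegral_mono_set hP.norm.integrableOn (ae_of_all _ fun _ => norm_nonneg _)
      (compl_subset_compl.2 hL).eventuallyLE)

variable [CompleteSpace E]

theorem IsFolnerSet.norm_setIntegral_setIntegral_sub_le (hB : IsFolnerSet m K ε B) {P : X → E}
    (hP : Integrable P m)
    (hPA : IntegrableOn (fun h => ∫ k in B + K, P (k - h) ∂m) (B + K) m) :
    ‖∫ h in B + K, ∫ k in B + K, P (k - h) ∂m ∂m - m.real (B + K) • ∫ t, P t ∂m‖ ≤
      m.real B * (∫ t in Kᶜ, ‖P t‖ ∂m + ε * ∫ t, ‖P t‖ ∂m) := by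
  have hconst : IntegrableOn (fun _ => ∫ t, P t ∂m) (B + K) m :=
    integrableOn_const hB.measure_add_ne_top
  have hF := hB.setIntegral_add_setIntegral_sdiff (hPA.sub hconst)
  simp only [Pi.sub_apply] at hF
  have hFB : ‖∫ h in B, (∫ k in B + K, P (k - h) ∂m - ∫ t, P t ∂m) ∂m‖ ≤
      (∫ t in Kᶜ, ‖P t‖ ∂m) * m.real B :=
    norm_setIntegral_le_of_norm_le_const hB.measure_ne_top.lt_top fun h hh =>
      norm_setIntegral_sub_right_sub_le hP hB.measurableSet_add (subset_preimage_add_right hh)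
  have hFdiff : ‖∫ h in (B + K) \ B, (∫ k in B + K, P (k - h) ∂m - ∫ t, P t ∂m) ∂m‖ ≤
      (∫ t, ‖P t‖ ∂m) * m.real ((B + K) \ B) :=
    norm_setIntegral_le_of_norm_le_const
      (measure_ne_top_of_subset sdiff_subset hB.measure_add_ne_top).lt_top fun h _ => by
        simpa using norm_setIntegral_sub_right_sub_le hP hB.measurableSet_add
          (empty_subset ((fun t => t + h) ⁻¹' (B + K)))
  rw [← setIntegral_const, ← integral_sub hPA hconst, ← hF]
  calc _ ≤ (∫ t in Kᶜ, ‖P t‖ ∂m) * m.real B + (∫ t, ‖P t‖ ∂m) * m.real ((B + K) \ B) :=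
        norm_add_le_of_le hFB hFdiff
    _ ≤ (∫ t in Kᶜ, ‖P t‖ ∂m) * m.real B + (∫ t, ‖P t‖ ∂m) * (ε * m.real B) := by
        gcongr
        exact hB.measureReal_sdiff_le
    _ = _ := by ring

theorem IsFolnerSequence.tendsto_average {K B : ℕ → Set X} (hB : IsFolnerSequence m K B)
    {P : X → E} (hP : Integrable P m)
    (hPA : ∀ n, IntegrableOn (fun h => ∫ k in B n + K n, P (k - h) ∂m) (B n + K n) m) :
    Tendsto (fun n => (m.real (B n + K n))⁻¹ •
      ∫ h in B n + K n, ∫ k in B n + K n, P (k - h) ∂m ∂m) atTop (𝓝 (∫ t, P t ∂m)) := by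
  have htail : Tendsto (fun n => ∫ t in (K n)ᶜ, ‖P t‖ ∂m) atTop (𝓝 0) := by
    have h := (hB.aecover.integral_tendsto_of_countably_generated hP.norm).const_sub (∫ t, ‖P t‖ ∂m)
    rw [sub_self] at h
    refine h.congr fun n => ?_
    rw [← integral_add_compl (hB.aecover.measurableSet n) hP.norm, add_sub_cancel_left]
  have herror : Tendsto (fun n : ℕ =>
      ∫ t in (K n)ᶜ, ‖P t‖ ∂m + 1 / ((n : ℝ) + 1) * ∫ t, ‖P t‖ ∂m) atTop (𝓝 0) := by
    simpa using htail.add (tendsto_one_div_add_atTop_nhds_zero_nat.mul_const (∫ t, ‖P t‖ ∂m))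
  refine tendsto_iff_norm_sub_tendsto_zero.2 (squeeze_zero (fun _ => norm_nonneg _) (fun n => ?_)
    herror)
  have hBn := hB.isFolnerSet n
  have hpos := hBn.measureReal_add_pos
  have herror_nonneg : 0 ≤ ∫ t in (K n)ᶜ, ‖P t‖ ∂m + 1 / ((n : ℝ) + 1) * ∫ t, ‖P t‖ ∂m := by
    positivity
  rw [← inv_smul_smul₀ hpos.ne' (∫ t, P t ∂m), ← smul_sub, norm_smul, norm_inv,
    Real.norm_of_nonneg hpos.le, inv_mul_le_iff₀ hpos]
  exact (hBn.norm_setIntegral_setIntegral_sub_le hP (hPA n)).trans (mul_le_mul_of_nonneg_right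
    (measureReal_mono hBn.subset_add hBn.measure_add_ne_top) herror_nonneg)

theorem IsPositiveDefinite.integral_nonneg {K B : ℕ → Set X} (hB : IsFolnerSequence m K B)
    {P : X → ℂ} (hP : IsPositiveDefinite P) (hPc : Continuous P) (hPint : Integrable P m) :
    0 ≤ ∫ t, P t ∂m := by
  have hfin (n : ℕ) : IsFiniteMeasure (m.restrict (B n + K n)) :=
    isFiniteMeasure_restrict.2 (hB.isFolnerSet n).measure_add_ne_top
  refine ge_of_tendsto' (hB.tendsto_average hPint fun n => hP.integrable_integral_sub _ hPc)
    fun n => ?_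
  exact smul_nonneg (by positivity) (hP.integral_integral_sub_nonneg _ hPc)

section Domination

variable {r p : X → ℝ} (hr : IsPositiveDefinite fun x => (r x : ℂ)) (hrc : Continuous r)
  (hp : Integrable p m) (hp0 : 0 ≤ p) (hrp : r ≤ p)
include hr hrc hp hp0 hrp

theorem IsPositiveDefinite.setIntegral_sub_right_le {A L : Set X} (hA : m A ≠ ⊤) {h : X}
    (hL : L ⊆ (fun t => t + h) ⁻¹' A) :
    ∫ k in A, r (k - h) ∂m ≤ ∫ t, p t ∂m - ∫ t in L, (p t - r t) ∂m := by
  have hrA : IntegrableOn r ((fun t => t + h) ⁻¹' A) m :=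
    hr.integrableOn_of_real hrc ((measure_preimage_add_right m h A).trans_ne hA)
  have hmono : ∫ t in L, (p t - r t) ∂m ≤ ∫ t in (fun t => t + h) ⁻¹' A, (p t - r t) ∂m :=
    setIntegral_mono_set (hp.integrableOn.sub hrA) (ae_of_all _ fun t => sub_nonneg.2 (hrp t))
      hL.eventuallyLE
  have hp_le : ∫ t in (fun t => t + h) ⁻¹' A, p t ∂m ≤ ∫ t, p t ∂m :=
    setIntegral_le_integral hp (ae_of_all _ hp0)
  rw [integral_sub hp.integrableOn hrA] at hmono
  rw [setIntegral_sub_right_eq]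
  linarith

theorem IsFolnerSet.setIntegral_sub_le (hB : IsFolnerSet m K ε B) :
    ∫ t in K, (p t - r t) ∂m ≤ (1 + ε) * ∫ t, p t ∂m := by
  have : IsFiniteMeasure (m.restrict (B + K)) := isFiniteMeasure_restrict.2 hB.measure_add_ne_top
  have hR : IntegrableOn (fun h => ∫ k in B + K, r (k - h) ∂m) (B + K) m := by
    simpa [IntegrableOn, integral_complex_ofReal] using
      (hr.integrable_integral_sub (m.restrict (B + K)) (by fun_prop)).re
  have hR_nonneg : 0 ≤ ∫ h in B + K, ∫ k in B + K, r (k - h) ∂m ∂m := by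
    simpa [integral_complex_ofReal] using
      hr.integral_integral_sub_nonneg (m.restrict (B + K)) (by fun_prop)
  have hRB : ∫ h in B, ∫ k in B + K, r (k - h) ∂m ∂m ≤
      m.real B * (∫ t, p t ∂m - ∫ t in K, (p t - r t) ∂m) := by
    rw [← smul_eq_mul, ← setIntegral_const]
    exact setIntegral_mono_on (hR.mono_set hB.subset_add) (integrableOn_const hB.measure_ne_top)
      hB.measurableSet fun h hh => hr.setIntegral_sub_right_le hrc hp hp0 hrp
        hB.measure_add_ne_top (subset_preimage_add_right hh)
  have hRdiff : ∫ h in (B + K) \ B, ∫ k in B + K, r (k - h) ∂m ∂m ≤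
      m.real ((B + K) \ B) * ∫ t, p t ∂m := by
    rw [← smul_eq_mul, ← setIntegral_const]
    refine setIntegral_mono (hR.mono_set sdiff_subset) (integrableOn_const
      (measure_ne_top_of_subset sdiff_subset hB.measure_add_ne_top)) fun h => ?_
    simpa using hr.setIntegral_sub_right_le hrc hp hp0 hrp hB.measure_add_ne_top
      (empty_subset ((fun t => t + h) ⁻¹' (B + K)))
  have hdiff := mul_le_mul_of_nonneg_right hB.measureReal_sdiff_le
    (show 0 ≤ ∫ t, p t ∂m from integral_nonneg hp0)
  rw [← hB.setIntegral_add_setIntegral_sdiff hR] at hR_nonneg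
  refine le_of_mul_le_mul_left ?_ hB.measureReal_pos
  linarith

theorem IsPositiveDefinite.integrable_of_le {K B : ℕ → Set X} (hB : IsFolnerSequence m K B) :
    Integrable r m := by
  have hrK (n : ℕ) : IntegrableOn r (K n) m := by
    obtain ⟨h, hh⟩ := nonempty_of_measureReal_ne_zero (hB.isFolnerSet n).measureReal_pos.ne'
    refine hr.integrableOn_of_real hrc (measure_ne_top_of_subset (subset_preimage_add_right hh) ?_)
    rw [measure_preimage_add_right]
    exact (hB.isFolnerSet n).measure_add_ne_top
  have hbound (n : ℕ) : ∫ t in K n, ‖p t - r t‖ ∂m ≤ 2 * ∫ t, p t ∂m := by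
    have hn : 1 + 1 / (n + 1 : ℝ) ≤ 2 := by
      linarith [div_le_one_of_le₀ (show (1 : ℝ) ≤ n + 1 by simp) (by positivity)]
    simp only [Real.norm_of_nonneg (sub_nonneg.2 (hrp _))]
    exact ((hB.isFolnerSet n).setIntegral_sub_le hr hrc hp hp0 hrp).trans
      (mul_le_mul_of_nonneg_right hn (MeasureTheory.integral_nonneg hp0))
  have hsub : Integrable (fun t => p t - r t) m :=
    hB.aecover.integrable_of_integral_norm_bounded _ (fun n => hp.integrableOn.sub (hrK n))
      (Eventually.of_forall hbound)
  exact (hp.sub hsub).congr (ae_of_all _ fun t => sub_sub_cancel (p t) (r t))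

end Domination

end Averaging

section CosetIntegral

variable {G : Type*} [AddCommGroup G] [TopologicalSpace G] [IsTopologicalAddGroup G]
  [MeasurableSpace G] [BorelSpace G] {H : AddSubgroup G} {m : Measure H}
  [m.IsAddLeftInvariant] {K B : ℕ → Set H} (hB : IsFolnerSequence m K B)
include hB

namespace IsPositiveDefinite

theorem integrable_coset {u : G → ℝ} (hu : IsPositiveDefinite fun x => (u x : ℂ))
    (huc : Continuous u) (hu0 : 0 ≤ u) (hint : Integrable (fun y : H => u y) m) (x : G) :
    Integrable (fun y : H => u (x + y)) m := by
  let r (y : H) : ℝ := 2 * u y - (u (x + y) + u (-x + y))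
  have hr : IsPositiveDefinite fun y => (r y : ℂ) := by
    convert (hu.sum_translates ![0, x] ![1, -1]).comp_addMonoidHom H.subtype using 2 with y
    simp only [r, Fin.sum_univ_two, Matrix.cons_val_zero, Matrix.cons_val_one,
      Matrix.cons_val_fin_one, AddSubgroup.subtype_apply, star_one, star_neg, sub_self, sub_zero,
      zero_sub, zero_add, neg_zero, Complex.ofReal_sub, Complex.ofReal_mul, Complex.ofReal_add,
      Complex.ofReal_ofNat]
    ring
  have hr_int : Integrable r m :=
    hr.integrable_of_le (by fun_prop) (hint.const_mul 2) (fun y => mul_nonneg zero_le_two (hu0 y))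
      (fun y => sub_le_self _ (add_nonneg (hu0 _) (hu0 _))) hB
  refine ((hint.const_mul 2).sub hr_int).mono'
    (Continuous.aestronglyMeasurable (by fun_prop)) (ae_of_all _ fun y => ?_)
  rw [Real.norm_of_nonneg (hu0 _), Pi.sub_apply, sub_sub_cancel]
  exact le_add_of_nonneg_right (hu0 _)

theorem integral_coset {f : G → ℂ} (hf : IsPositiveDefinite f) (hfc : Continuous f)
    (hint : ∀ x, Integrable (fun y : H => f (x + y)) m) :
    IsPositiveDefinite fun x => ∫ y : H, f (x + y) ∂m := by
  refine isPositiveDefinite_of_sum_nonneg fun n x c => ?_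
  have hterm (i j : Fin n) : Integrable
      (fun y : H => star (c i) * c j * f (x j - x i + y)) m := (hint _).const_mul _
  have hsum (i : Fin n) : Integrable
      (fun y : H => ∑ j, star (c i) * c j * f (x j - x i + y)) m :=
    integrable_finsetSum _ fun j _ => hterm i j
  calc 0 ≤ ∫ y : H, ∑ i, ∑ j, star (c i) * c j * f (x j - x i + y) ∂m :=
        ((hf.sum_translates x c).comp_addMonoidHom H.subtype).integral_nonneg hB
          (by simp only [AddSubgroup.subtype_apply]; fun_prop)
          (integrable_finsetSum _ fun i _ => hsum i)
    _ = ∑ i, ∑ j, star (c i) * c j * ∫ y : H, f (x j - x i + y) ∂m := by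
        rw [integral_finsetSum _ fun i _ => hsum i]
        simp only [integral_finsetSum _ fun j _ => hterm _ j, integral_const_mul]

end IsPositiveDefinite

end CosetIntegral

section CosetAverage

variable {G : Type*} [AddCommGroup G] [TopologicalSpace G] [IsTopologicalAddGroup G]
  [MeasurableSpace G] {H : AddSubgroup G} {u : G → ℝ}

theorem integral_coset_pos {m : Measure H} [m.IsOpenPosMeasure]
    (huc : Continuous u) (hu0 : ∀ x, 0 < u x)
    (hint : ∀ x, Integrable (fun y : H => u (x + y)) m) (x : G) : 0 < ∫ y : H, u (x + y) ∂m :=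
  integral_pos_of_integrable_nonneg_nonzero (x := 0) (by fun_prop) (hint x)
    (fun _ => (hu0 _).le) (hu0 _).ne'

variable [BorelSpace G] {m : Measure H} [m.IsAddHaarMeasure]

theorem cosetAverage_pos (huc : Continuous u) (hu0 : ∀ x, 0 < u x)
    (hint : ∀ x, Integrable (fun y : H => u (x + y)) m) (q : G ⧸ H) : 0 < cosetAverage H m u q := by
  obtain ⟨x, rfl⟩ := QuotientAddGroup.mk_surjective q
  exact div_pos (integral_coset_pos huc hu0 hint x)
    (by simpa using integral_coset_pos huc hu0 hint 0)

theorem cosetAverage_zero (hu : ∫ y : H, u y ∂m ≠ 0) : cosetAverage H m u 0 = 1 := by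
  rw [← QuotientAddGroup.mk_zero]
  change (∫ y : H, u (0 + y) ∂m) / ∫ y : H, u y ∂m = 1
  simp only [zero_add, div_self hu]

theorem isPositiveDefinite_cosetAverage {K B : ℕ → Set H} (hB : IsFolnerSequence m K B)
    (hu : IsPositiveDefinite fun x => (u x : ℂ)) (huc : Continuous u) (hu0 : 0 ≤ u)
    (hint : ∀ x, Integrable (fun y : H => u (x + y)) m) :
    IsPositiveDefinite fun q => (cosetAverage H m u q : ℂ) := by
  have hcoset := hu.integral_coset hB (by fun_prop) fun x => (hint x).ofReal
  have hpos : (0 : ℂ) ≤ ((∫ y : H, u y ∂m)⁻¹ : ℝ) :=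
    Complex.zero_le_real.2 (inv_nonneg.2 (integral_nonneg fun _ => hu0 _))
  refine isPositiveDefinite_of_comp_surjective (QuotientAddGroup.mk'_surjective H) ?_
  convert hcoset.const_mul hpos using 2 with x
  rw [integral_complex_ofReal, ← Complex.ofReal_mul, mul_comm]
  rfl

end CosetAverage

namespace GhostSpace

/-- The ghost-space with a given weight; its convolution is forced by the weight, and its evenness
by positive-definiteness. -/
noncomputable def ofWeight {A : Type*} [AddCommGroup A] [TopologicalSpace A] (v : A → ℝ)
    (hvc : Continuous v) (hv0 : ∀ x, 0 < v x) (hv1 : v 0 = 1)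
    (hv : IsPositiveDefinite fun x => (v x : ℂ)) : GhostSpace A where
  weight := v
  continuous_weight := hvc
  weight_pos := hv0
  weight_neg := hv.apply_neg_of_real
  weight_zero := hv1
  posDef_weight := hv
  conv x y := ENNReal.ofReal (v x * v y / v (x + y)) • @Measure.dirac A (borel A) (x + y)
  conv_eq _ _ := rfl

end GhostSpace

theorem proposition3p2_general {G : Type*} [AddCommGroup G] [TopologicalSpace G]
    [IsTopologicalAddGroup G] [MeasurableSpace G] [BorelSpace G] (H : AddSubgroup G)
    (S : GhostSpace G) (mH : Measure H) [mH.IsAddHaarMeasure]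
    (hintH : Integrable (fun y : H => S.weight y) mH) :
    (∀ x : G, Integrable (fun y : H => S.weight (x + y)) mH) ∧
    (Continuous (cosetAverage H mH S.weight) →
      IsPositiveDefinite (fun q : G ⧸ H => (cosetAverage H mH S.weight q : ℂ)) ∧
      ∃ Q : GhostSpace (G ⧸ H), Q.weight = cosetAverage H mH S.weight) := by
  have hu := S.posDef_weight
  have huc := S.continuous_weight
  have hu0 : 0 ≤ S.weight := fun x => (S.weight_pos x).le
  obtain ⟨K, B, hB⟩ := exists_isFolnerSequence (hu.comp_addMonoidHom H.subtype)
    (huc.comp continuous_subtype_val) (fun y => S.weight_pos y) hintH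
  have hint := hu.integrable_coset hB huc hu0 hintH
  have hv := isPositiveDefinite_cosetAverage hB hu huc hu0 hint
  have hH0 : ∫ y : H, S.weight y ∂mH ≠ 0 := by
    simpa using (integral_coset_pos huc S.weight_pos hint 0).ne'
  exact ⟨hint, fun hvc => ⟨hv, .ofWeight _ hvc (cosetAverage_pos huc S.weight_pos hint)
    (cosetAverage_zero hH0) hv, rfl⟩⟩

/-- `S` is the ghost-space `G_u` with `u = S.weight`; the last clause says that `(G ⧸ H)_v` is
a ghost-space, the quotient `G_u / H_u`. -/
theorem proposition3p2 {G : Type*} [AddCommGroup G] [TopologicalSpace G]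
    [IsTopologicalAddGroup G] [LocallyCompactSpace G] [MeasurableSpace G] [BorelSpace G]
    (H : AddSubgroup G) (hH : IsClosed (H : Set G)) (S : GhostSpace G)
    (mG : Measure G) [mG.IsAddHaarMeasure] (mH : Measure H) [mH.IsAddHaarMeasure]
    (hintG : Integrable S.weight mG) (hintH : Integrable (fun y : H => S.weight y) mH) :
    (∀ x : G, Integrable (fun y : H => S.weight (x + y)) mH) ∧
    (Continuous (cosetAverage H mH S.weight) →
      IsPositiveDefinite (fun q : G ⧸ H => (cosetAverage H mH S.weight q : ℂ)) ∧
      ∃ Q : GhostSpace (G ⧸ H), Q.weight = cosetAverage H mH S.weight) :=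
  proposition3p2_general H S mH hintH
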